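/- Let $K$ be an algebraically closed field of characteristic $0$, let $c\ge 0$ be an integer, let $a_0,\dots,a_{c+1}$ and $d_1,\dots,d_c$ be positive integers, and let $\mathbb{P}(a_0,\dots,a_{c+1})=\operatorname{Proj}K[x_0,\dots,x_{c+1}]$ with $\deg x_i=a_i$. Let $C=(f_1=\dots=f_c=0)\subset\mathbb{P}(a_0,\dots,a_{c+1})$ be any weighted complete intersection curve of multi-degrees $(d_1,\dots,d_c)$ (in particular, $C$ may be a general one); that is, $f_j$ is weighted homogeneous of degree $d_j$, the sequence $f_1,\dots,f_c$ is regular, and $C=\operatorname{Proj}K[x_0,\dots,x_{c+1}]/(f_1,\dots,f_c)$. 1. If $C$ is quasi-smooth, i.e. its affine cone $\operatorname{Spec}K[x_0,\dots,x_{c+1}]/(f_1,\dots,f_c)$ is smooth over $K$ outside the origin, then $C$ is irreducible; moreover, it is connected and nonsingular (all its local rings are regular). 2. If $C$ contains a one-dimensional coordinate stratum $L=\{x_k=0 \text{ for all } k\ne i,j\}$ (where $i\neq j$) of $\mathbb{P}(a_0,\dots,a_{c+1})$, and $C\ne L$ as sets, then $C$ is not irreducible. -/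

import Mathlib

open MvPolynomial AlgebraicGeometry CategoryTheory

noncomputable section

attribute [local instance] MvPolynomial.weightedGradedAlgebra

/-! ### The quotient of a graded algebra by a homogeneous ideal -/

namespace QuotGrading

universe u v

variable {K : Type v} {A : Type u} [CommRing K] [CommRing A] [Algebra K A]
  (𝒜 : ℕ → Submodule K A) [GradedAlgebra 𝒜] (I : HomogeneousIdeal 𝒜)

/-- The degree `n` part of `A ⧸ I`: the image of the degree `n` part of `A`. -/
def piece (n : ℕ) : Submodule K (A ⧸ I.toIdeal) :=
  (𝒜 n).map (Ideal.Quotient.mkₐ K I.toIdeal).toLinearMap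

theorem mk_mem_piece {n : ℕ} {x : A} (hx : x ∈ 𝒜 n) :
    Ideal.Quotient.mk I.toIdeal x ∈ piece 𝒜 I n :=
  ⟨x, hx, rfl⟩

instance gradedMonoid : SetLike.GradedMonoid (piece 𝒜 I) where
  one_mem := ⟨1, SetLike.GradedOne.one_mem, rfl⟩
  mul_mem := by
    rintro i j _ _ ⟨x, hx, rfl⟩ ⟨y, hy, rfl⟩
    exact ⟨x * y, SetLike.GradedMul.mul_mem hx hy, rfl⟩

/-- The homogeneous components of the class of `x` in `A ⧸ I`. -/
def components : A →+ DirectSum ℕ (fun n => piece 𝒜 I n) :=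
  (DirectSum.map (fun n =>
    { toFun := fun x : 𝒜 n =>
        (⟨Ideal.Quotient.mk I.toIdeal x, mk_mem_piece 𝒜 I x.2⟩ : piece 𝒜 I n)
      map_zero' := rfl
      map_add' := fun _ _ => rfl })).comp
    (DirectSum.decomposeAddEquiv 𝒜).toAddMonoidHom

theorem components_apply (x : A) (n : ℕ) :
    ((components 𝒜 I x n : piece 𝒜 I n) : A ⧸ I.toIdeal) =
      Ideal.Quotient.mk I.toIdeal (DirectSum.decompose 𝒜 x n : A) :=
  rfl

theorem components_of_mem {n : ℕ} {x : A} (hx : x ∈ 𝒜 n) :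
    components 𝒜 I x =
      DirectSum.of (fun n => piece 𝒜 I n) n
        ⟨Ideal.Quotient.mk I.toIdeal x, mk_mem_piece 𝒜 I hx⟩ := by
  simp only [components, AddMonoidHom.comp_apply]
  change DirectSum.map _ (DirectSum.decompose 𝒜 x) = _
  rw [DirectSum.decompose_of_mem 𝒜 hx, DirectSum.map_of]
  rfl

theorem components_eq {x y : A}
    (h : Ideal.Quotient.mk I.toIdeal x = Ideal.Quotient.mk I.toIdeal y) :
    components 𝒜 I x = components 𝒜 I y := by
  have hxy : x - y ∈ I.toIdeal := Ideal.Quotient.eq.mp h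
  have h0 : components 𝒜 I (x - y) = 0 := DFinsupp.ext fun n => Subtype.ext
    ((components_apply 𝒜 I _ n).trans (Ideal.Quotient.eq_zero_iff_mem.mpr (I.isHomogeneous n hxy)))
  rw [← sub_add_cancel x y, (components 𝒜 I).map_add, h0, zero_add]

/-- The homogeneous components of an element of `A ⧸ I`. -/
def decomp (y : A ⧸ I.toIdeal) : DirectSum ℕ (fun n => piece 𝒜 I n) :=
  components 𝒜 I (Function.surjInv Ideal.Quotient.mk_surjective y)

theorem decomp_mk (x : A) :
    decomp 𝒜 I (Ideal.Quotient.mk I.toIdeal x) = components 𝒜 I x :=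
  components_eq 𝒜 I (Function.surjInv_eq Ideal.Quotient.mk_surjective _)

theorem decomp_add (y z : A ⧸ I.toIdeal) :
    decomp 𝒜 I (y + z) = decomp 𝒜 I y + decomp 𝒜 I z := by
  obtain ⟨x, rfl⟩ := Ideal.Quotient.mk_surjective y
  obtain ⟨w, rfl⟩ := Ideal.Quotient.mk_surjective z
  rw [← map_add, decomp_mk, decomp_mk, decomp_mk, (components 𝒜 I).map_add]

theorem decomp_zero : decomp 𝒜 I 0 = 0 :=
  (decomp_mk 𝒜 I 0).trans (components 𝒜 I).map_zero

/-- The quotient of a graded algebra by a homogeneous ideal is graded by the images of the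
homogeneous parts. -/
instance gradedAlgebra : GradedAlgebra (piece 𝒜 I) where
  decompose' := decomp 𝒜 I
  left_inv := by
    intro y
    obtain ⟨x, rfl⟩ := Ideal.Quotient.mk_surjective y
    rw [decomp_mk]
    induction x using DirectSum.Decomposition.inductionOn 𝒜 with
    | zero => rw [(components 𝒜 I).map_zero, map_zero, map_zero]
    | homogeneous m => rw [components_of_mem 𝒜 I m.2, DirectSum.coeAddMonoidHom_of]
    | add m m' h h' => rw [(components 𝒜 I).map_add, map_add, h, h', map_add]
  right_inv := by
    intro z
    induction z using DirectSum.induction_on with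
    | zero => rw [map_zero, decomp_zero]
    | of n m =>
      obtain ⟨y, hy⟩ := m
      obtain ⟨x, hx, rfl⟩ := id hy
      rw [DirectSum.coeAddMonoidHom_of]
      exact (decomp_mk 𝒜 I x).trans (components_of_mem 𝒜 I hx)
    | add z w hz hw => rw [map_add, decomp_add, hz, hw]

/-- The quotient map as a homomorphism of graded rings. -/
def mkGraded : GradedRingHom 𝒜 (piece 𝒜 I) where
  __ := Ideal.Quotient.mk I.toIdeal
  map_mem hx := mk_mem_piece 𝒜 I hx

open HomogeneousIdeal in
theorem irrelevant_le_map :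
    irrelevant (piece 𝒜 I) ≤ (irrelevant 𝒜).map (mkGraded 𝒜 I) := by
  rw [irrelevant_le]
  rintro i hi _ ⟨x, hx, rfl⟩
  exact Ideal.mem_map_of_mem _ (mem_irrelevant_of_mem 𝒜 hi hx)

end QuotGrading

/-! ### Weighted projective spaces and weighted complete intersections -/

namespace WeightedProj

universe u

variable (K : Type u) [Field K] {n c : ℕ}

/-- The weighted projective space `ℙ(a₀, …, aₙ₋₁) = Proj K[x₀, …, xₙ₋₁]`, with `deg xᵢ = aᵢ`. -/
def space (a : Fin n → ℕ) : Scheme.{u} :=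
  Proj (weightedHomogeneousSubmodule K a)

/-- The (closed) coordinate stratum `{xₖ = 0 for all k ∉ s}` of `ℙ(a₀, …, aₙ₋₁)`; it has
dimension `#s - 1`. -/
def stratum (a : Fin n → ℕ) (s : Finset (Fin n)) : Set (space K a) :=
  ProjectiveSpectrum.zeroLocus (weightedHomogeneousSubmodule K a)
    {p | ∃ k ∉ s, p = (X k : MvPolynomial (Fin n) K)}

variable {K} (a : Fin n → ℕ) (d : Fin c → ℕ)
  (f : (j : Fin c) → weightedHomogeneousSubmodule K a (d j))

/-- The homogeneous ideal `(f₁, …, f_c)` generated by weighted homogeneous polynomials `fⱼ` of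
degrees `dⱼ`. -/
def ideal : HomogeneousIdeal (weightedHomogeneousSubmodule K a) where
  toSubmodule := Ideal.span (Set.range fun j => (f j : MvPolynomial (Fin n) K))
  is_homogeneous' := Ideal.homogeneous_span _ _ (by
    rintro _ ⟨j, rfl⟩
    exact ⟨d j, (f j).2⟩)

/-- The homogeneous coordinate ring `K[x₀, …, xₙ₋₁] ⧸ (f₁, …, f_c)`; its spectrum is the affine
cone of the closed subscheme `(f₁ = ⋯ = f_c = 0)`. -/
abbrev coordRing : Type u := MvPolynomial (Fin n) K ⧸ (ideal a d f).toIdeal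

/-- The closed subscheme `(f₁ = ⋯ = f_c = 0)` of `ℙ(a₀, …, aₙ₋₁)`. -/
def locus : Scheme.{u} :=
  Proj (QuotGrading.piece (weightedHomogeneousSubmodule K a) (ideal a d f))

/-- The inclusion of `(f₁ = ⋯ = f_c = 0)` in `ℙ(a₀, …, aₙ₋₁)`. -/
def inclusion : locus a d f ⟶ space K a :=
  Proj.map (QuotGrading.mkGraded (weightedHomogeneousSubmodule K a) (ideal a d f))
    (QuotGrading.irrelevant_le_map (weightedHomogeneousSubmodule K a) (ideal a d f))

/-- The points of `ℙ(a₀, …, aₙ₋₁)` that lie on `(f₁ = ⋯ = f_c = 0)`. -/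
def support : Set (space K a) := Set.range (inclusion a d f)

/-- `(f₁ = ⋯ = f_c = 0)` is a weighted complete intersection (of codimension `c`) if `f₁, …, f_c`
is a regular sequence. -/
def IsCompleteIntersection : Prop :=
  RingTheory.Sequence.IsRegular (MvPolynomial (Fin n) K)
    (List.ofFn fun j => (f j : MvPolynomial (Fin n) K))

/-- `(f₁ = ⋯ = f_c = 0)` is quasi-smooth if its affine cone is smooth over `K` at every point
other than the origin `x₀ = ⋯ = xₙ₋₁ = 0`. -/
def IsQuasiSmooth : Prop :=
  ∀ p : PrimeSpectrum (coordRing a d f),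
    (∃ i, Ideal.Quotient.mk (ideal a d f).toIdeal (X i) ∉ p.asIdeal) →
      p ∈ Algebra.smoothLocus K (coordRing a d f)

end WeightedProj

/-- A scheme is nonsingular if all of its local rings are regular. -/
def IsNonsingular (X : Scheme) : Prop :=
  ∀ x : X, IsRegularLocalRing (X.presheaf.stalk x)

end

/-!
Let `S = K[x₀, …, x_{c+1}]` and let `R = S ⧸ (f₁, …, f_c)` be the homogeneous coordinate ring of
the curve. Two facts about `R` carry the proof. Its Krull dimension is at most `2`, because every
element of a regular sequence lowers the dimension of `S`, which is `c + 2`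
(`WeightedProj.ringKrullDim_coordRing_add_le`). Its depth at the origin is at least `2`, because
the `c + 2` variables form a regular sequence in `S`, and by the Rees theorem the length of a
regular sequence in an ideal drops by at most `c` modulo `f₁, …, f_c`
(`WeightedProj.exists_regular_pair`).

Suppose the curve is quasi-smooth. A homogeneous prime `p` of `R` other than the ideal of the
origin has height at most `1`. An algebra smooth at a point is étale over a polynomial ring near
it, so `R_p` is a regular local ring, hence a field or a discrete valuation ring. Thus the
punctured cone is locally integral, and depth `2` makes it connected by a graded version of
Hartshorne's argument: `R` is a domain (`isDomain_of_isDomain_localization_of_regular_pair`), so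
its zero ideal is a generic point of `Proj R`. The local ring of `Proj R` at `p` is the degree zero
part of the localization of `R` at `p` with respect to homogeneous elements. Divisibility between
its elements can be tested in `R_p`, whatever the weights are. It is therefore a principal ideal
domain along with `R_p`, and in particular regular.

Suppose the curve is irreducible and contains the coordinate line `L`. Its generic point is a
homogeneous prime `P` contained in the prime `Q` of `L`. If `P ≠ Q`, then `P`, `Q`, the prime of a
coordinate point of `L`, and the ideal of the origin form a chain of length `3` in `R`, against
`dim R ≤ 2`. So `P = Q`, and the curve is the closure `L` of its generic point
(`WeightedProj.stratum_eq_support`).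
-/

/-! ### Regular local rings and smoothness -/

open IsLocalRing in
/-- A regular local ring of dimension at most one is a principal ideal domain. If the dimension is
one, the maximal ideal is principal, and Nakayama's lemma kills every prime ideal that does not
contain its generator. -/
theorem IsRegularLocalRing.isDomain_and_isPrincipalIdealRing_of_ringKrullDim_le_one
    (R : Type*) [CommRing R] [IsRegularLocalRing R] (h : ringKrullDim R ≤ 1) :
    IsDomain R ∧ IsPrincipalIdealRing R := by
  have hs := IsRegularLocalRing.spanFinrank_maximalIdeal (R := R)
  have hs1 : (maximalIdeal R).spanFinrank ≤ 1 := by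
    rw [← hs] at h
    exact_mod_cast h
  obtain h0 | h1 : (maximalIdeal R).spanFinrank = 0 ∨ (maximalIdeal R).spanFinrank = 1 := by
    omega
  · have hbot : maximalIdeal R = ⊥ :=
      (Submodule.spanFinrank_eq_zero_iff_eq_bot (IsNoetherian.noetherian _)).mp h0
    have hF : IsField R := isField_iff_maximalIdeal_eq.mpr hbot
    let := hF.toField
    exact ⟨hF.isDomain, inferInstance⟩
  · obtain ⟨s, hcard, hspan⟩ :=
      Submodule.FG.exists_span_set_encard_eq_spanFinrank
        (IsNoetherian.noetherian (maximalIdeal R))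
    rw [h1, Nat.cast_one, Set.encard_eq_one] at hcard
    obtain ⟨x, rfl⟩ := hcard
    have hprin : (maximalIdeal R).IsPrincipal := ⟨x, hspan.symm⟩
    obtain ⟨P, hP, hxP⟩ : ∃ P : Ideal R, P.IsPrime ∧ x ∉ P := by
      by_contra! hcon
      have : Ring.KrullDimLE 0 R := by
        rw [Ring.krullDimLE_zero_iff]
        intro I hI
        have : I = maximalIdeal R := by
          refine le_antisymm (le_maximalIdeal hI.ne_top) ?_
          rw [← hspan]
          exact Submodule.span_le.mpr (by simpa using hcon I hI)
        exact this ▸ inferInstance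
      have h0 := Ring.krullDimLE_iff.mp this
      rw [← hs, h1] at h0
      exact absurd h0 (by norm_num)
    have hPbot : P = ⊥ := by
      refine Submodule.eq_bot_of_le_smul_of_le_jacobson_bot (maximalIdeal R) P
        (IsNoetherian.noetherian _) ?_ (maximalIdeal_le_jacobson _)
      intro y hy
      have hym : y ∈ Ideal.span {x} := by
        rw [Ideal.span, hspan]
        exact le_maximalIdeal hP.ne_top hy
      obtain ⟨z, rfl⟩ := Ideal.mem_span_singleton'.mp hym
      have hz : z ∈ P := (hP.mem_or_mem hy).resolve_right hxP
      rw [mul_comm]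
      refine Submodule.smul_mem_smul ?_ hz
      rw [← hspan]
      exact Submodule.mem_span_singleton_self x
    have : (⊥ : Ideal R).IsPrime := hPbot ▸ hP
    have : IsDomain R := IsDomain.of_bot_isPrime R
    exact ⟨this, ((tfae_of_isNoetherianRing_of_isLocalRing_of_isDomain R).out 0 4).mpr hprin⟩

open IsLocalRing in
/-- Regularity ascends along an étale algebra: the maximal ideal upstairs is generated by the one
downstairs, and the dimension does not drop by going down. -/
theorem Algebra.Etale.isRegularLocalRing_localization
    (A B : Type*) [CommRing A] [CommRing B] [Algebra A B] [IsRegularRing A]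
    [Algebra.Etale A B] (q : Ideal B) [q.IsPrime] :
    IsRegularLocalRing (Localization.AtPrime q) := by
  have : IsNoetherianRing B := Algebra.FiniteType.isNoetherianRing A B
  let p := q.under A
  let := Localization.AtPrime.algebraOfLiesOver p q
  have hmap : p.map (algebraMap A (Localization.AtPrime q)) = maximalIdeal _ :=
    (Algebra.isUnramifiedAt_iff_map_eq A p q).mp inferInstance |>.2
  have : IsNoetherianRing (Localization.AtPrime q) :=
    IsLocalization.isNoetherianRing q.primeCompl _ inferInstance
  apply IsRegularLocalRing.of_spanFinrank_maximalIdeal_le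
  have h1 : (maximalIdeal (Localization.AtPrime q)).spanFinrank ≤
      (maximalIdeal (Localization.AtPrime p)).spanFinrank := by
    rw [← hmap, IsScalarTower.algebraMap_eq A (Localization.AtPrime p), ← Ideal.map_map,
      Localization.AtPrime.map_eq_maximalIdeal]
    exact Ideal.spanFinrank_map_le_of_fg _ (IsNoetherian.noetherian _)
  have h2 : ((maximalIdeal (Localization.AtPrime p)).spanFinrank : WithBot ℕ∞) =
      ringKrullDim (Localization.AtPrime p) :=
    IsRegularLocalRing.spanFinrank_maximalIdeal
  refine le_trans (by exact_mod_cast h1) (h2.le.trans ?_)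
  rw [IsLocalization.AtPrime.ringKrullDim_eq_height p,
    IsLocalization.AtPrime.ringKrullDim_eq_height q,
    Ideal.height_eq_height_add_of_liesOver_of_hasGoingDown p q]
  exact_mod_cast le_self_add

/-- The local ring of an algebra of finite type over a field at a smooth point is regular: near the
point, the algebra is étale over a polynomial ring. -/
theorem Algebra.IsSmoothAt.isRegularLocalRing_localization
    (K A : Type*) [Field K] [CommRing A] [Algebra K A] [Algebra.FiniteType K A]
    (p : Ideal A) [p.IsPrime] [Algebra.IsSmoothAt K p] :
    IsRegularLocalRing (Localization.AtPrime p) := by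
  have : Algebra.FinitePresentation K A := Algebra.FinitePresentation.of_finiteType.mp inferInstance
  obtain ⟨f, hf, n, _, _, _⟩ :=
    Algebra.IsSmoothAt.exists_isStandardEtale_mvPolynomial (R := K) (p := p)
  let B := Localization.Away f
  have hdisj : Disjoint (Submonoid.powers f : Set A) p :=
    (Ideal.disjoint_powers_iff_notMem_of_isPrime _).mpr hf
  let q : Ideal B := p.map (algebraMap A B)
  have hq : q.IsPrime := IsLocalization.isPrime_of_isPrime_disjoint (.powers f) B p ‹_› hdisj
  have hqp : q.under A = p :=
    IsLocalization.under_map_of_isPrime_disjoint (.powers f) B ‹_› hdisj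
  have : IsRegularLocalRing (Localization.AtPrime q) :=
    Algebra.Etale.isRegularLocalRing_localization (MvPolynomial (Fin n) K) B q
  let e : Localization.AtPrime (q.under A) ≃ₐ[A] Localization.AtPrime q :=
    IsLocalization.localizationLocalizationAtPrimeIsoLocalization (.powers f) q
  have h3 := IsRegularLocalRing.of_ringEquiv e.symm.toRingEquiv
  clear_value q
  subst hqp
  exact h3

/-! ### Graded rings of depth at least two -/

section Graded

variable {A σ : Type*} [CommRing A] [SetLike σ A] [AddSubgroupClass σ A]
  {𝒜 : ℕ → σ} [GradedRing 𝒜]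

open DirectSum

theorem Ideal.IsHomogeneous.annihilator {I : Ideal A} (hI : I.IsHomogeneous 𝒜) :
    Ideal.IsHomogeneous 𝒜 (Submodule.annihilator I : Ideal A) := by
  classical
  intro i t ht
  rw [Submodule.mem_annihilator] at ht ⊢
  intro s hs
  rw [← DirectSum.sum_support_decompose 𝒜 s, Finset.smul_sum]
  refine Finset.sum_eq_zero fun j _ => ?_
  have h := ht _ (hI j hs)
  rw [smul_eq_mul] at h ⊢
  rw [← DirectSum.coe_decompose_mul_add_of_right_mem 𝒜 (SetLike.coe_mem (decompose 𝒜 s j)), h,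
    DirectSum.decompose_zero]
  rfl

/-- A homogeneous ideal contained in no point of `Proj` has the irrelevant ideal in its radical: the
homogeneous core of a prime ideal above it is again prime. -/
theorem Ideal.IsHomogeneous.irrelevant_le_radical {L : Ideal A} (hL : L.IsHomogeneous 𝒜)
    (h : ∀ x : ProjectiveSpectrum 𝒜, ¬ L ≤ x.asHomogeneousIdeal.toIdeal) :
    (HomogeneousIdeal.irrelevant 𝒜).toIdeal ≤ L.radical := by
  rw [Ideal.radical_eq_sInf]
  refine le_sInf fun p ⟨hLp, hp⟩ => ?_
  by_contra hirr
  refine h ⟨p.homogeneousCore 𝒜, hp.homogeneousCore, fun hle => hirr ?_⟩ ?_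
  · exact le_trans hle (Ideal.toIdeal_homogeneousCore_le 𝒜 p)
  · change L ≤ (p.homogeneousCore 𝒜).toIdeal
    rw [← hL.toIdeal_homogeneousCore_eq_self]
    exact Ideal.homogeneousCore_mono 𝒜 hLp

theorem Ideal.IsHomogeneous.le_irrelevant (h0 : ∀ r ∈ 𝒜 0, r ≠ 0 → IsUnit r)
    {I : Ideal A} (hI : I.IsHomogeneous 𝒜) (hne : I ≠ ⊤) :
    I ≤ (HomogeneousIdeal.irrelevant 𝒜).toIdeal := by
  intro r hr
  by_contra hirr
  refine hne (I.eq_top_of_isUnit_mem (hI 0 hr) (h0 _ (SetLike.coe_mem _) fun h => hirr ?_))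
  change r ∈ HomogeneousIdeal.irrelevant 𝒜
  rw [HomogeneousIdeal.mem_irrelevant_iff, GradedRing.proj_apply]
  exact h

/-- Powers of a regular pair form a regular pair. -/
theorem exists_eq_pow_mul_of_regular_pair {x y : A} (hx : x ∈ nonZeroDivisors A)
    (hxy : ∀ t s, y * t = x * s → ∃ w, t = x * w) (m n : ℕ) {t s : A}
    (h : y ^ m * t = x ^ n * s) : ∃ w, t = x ^ n * w := by
  have key : ∀ (m : ℕ) (t s : A), y ^ m * t = x * s → ∃ w, t = x * w := by
    intro m
    induction m with
    | zero => exact fun t s h => ⟨s, by simpa using h⟩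
    | succ m ih =>
      intro t s h
      obtain ⟨w, hw⟩ := hxy (y ^ m * t) s (by rw [← h]; ring)
      exact ih t w hw
  induction n generalizing t s with
  | zero => exact ⟨t, by simp⟩
  | succ n ih =>
    obtain ⟨w, rfl⟩ := key m t (x ^ n * s) (by rw [h]; ring)
    have h' : y ^ m * w = x ^ n * s := by
      refine mul_cancel_left_mem_nonZeroDivisors hx |>.mp ?_
      linear_combination h
    obtain ⟨v, rfl⟩ := ih h'
    exact ⟨v, by ring⟩

theorem exists_notMem_mul_eq_zero_of_algebraMap_eq_zero {q : Ideal A} [q.IsPrime] {r : A}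
    (h : algebraMap A (Localization.AtPrime q) r = 0) : ∃ s ∉ q, s * r = 0 := by
  obtain ⟨⟨s, hs⟩, h⟩ := (IsLocalization.map_eq_zero_iff q.primeCompl _ r).mp h
  exact ⟨s, hs, h⟩

/-- A graded form of Hartshorne's connectedness theorem. Let `a` be homogeneous, `I` its
annihilator, and `J` the annihilator of `I`. As the localizations of the ring at the points of
`Proj` are domains, `I ⊔ J` lies in no such point, while every homogeneous element of `I ⊓ J`
vanishes locally. Powers of the regular pair `x, y` lie in `I ⊔ J`, and comparing their
decompositions gives `1 ∈ I ⊔ J`. As proper homogeneous ideals lie in the irrelevant ideal, one of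
`I`, `J` is the unit ideal, that is, `a` is zero or a nonzerodivisor. -/
theorem isDomain_of_isDomain_localization_of_regular_pair [IsNoetherianRing A] [Nontrivial A]
    (h0 : ∀ r ∈ 𝒜 0, r ≠ 0 → IsUnit r)
    (hloc : ∀ p : ProjectiveSpectrum 𝒜,
      IsDomain (Localization.AtPrime p.asHomogeneousIdeal.toIdeal))
    {x y : A} (hxirr : x ∈ HomogeneousIdeal.irrelevant 𝒜)
    (hyirr : y ∈ HomogeneousIdeal.irrelevant 𝒜) (hx : x ∈ nonZeroDivisors A)
    (hxy : ∀ t s, y * t = x * s → ∃ w, t = x * w) : IsDomain A := by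
  classical
  suffices hbot : (⊥ : Ideal A).IsPrime from IsDomain.of_bot_isPrime A
  refine (HomogeneousIdeal.isHomogeneous (⊥ : HomogeneousIdeal 𝒜)
    ).isPrime_of_homogeneous_mem_or_mem bot_ne_top ?_
  rintro a b ⟨k, hak⟩ - hab
  by_contra! hne
  simp only [HomogeneousIdeal.toIdeal_bot, Ideal.mem_bot] at hab hne
  obtain ⟨ha, hb⟩ := hne
  let I : Ideal A := Submodule.annihilator (Ideal.span {a})
  let J : Ideal A := Submodule.annihilator I
  have memI : ∀ t, t ∈ I ↔ t * a = 0 := fun t => Submodule.mem_annihilator_span_singleton a t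
  have memJ : ∀ t, t ∈ J ↔ ∀ s ∈ I, t * s = 0 := fun t => Submodule.mem_annihilator
  have homI : I.IsHomogeneous 𝒜 := (Ideal.homogeneous_span 𝒜 _ (by
    rintro _ rfl
    exact ⟨k, hak⟩)).annihilator
  have homJ : J.IsHomogeneous 𝒜 := homI.annihilator
  have hIJ : ∀ p : ProjectiveSpectrum 𝒜, ¬ I ⊔ J ≤ p.asHomogeneousIdeal.toIdeal := by
    intro p hp
    have := hloc p
    by_cases hap : algebraMap A (Localization.AtPrime p.asHomogeneousIdeal.toIdeal) a = 0
    · obtain ⟨s, hs, hsa⟩ := exists_notMem_mul_eq_zero_of_algebraMap_eq_zero hap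
      exact hs (hp (Ideal.mem_sup_left ((memI s).mpr hsa)))
    · have hsupp : (⟨p.asHomogeneousIdeal.toIdeal, p.isPrime⟩ : PrimeSpectrum A) ∈
          Module.support A I := by
        rw [Module.mem_support_iff_of_finite]
        exact le_trans le_sup_right hp
      refine absurd hsupp (Module.notMem_support_iff'.mpr fun ⟨s, hs⟩ => ?_)
      have hs0 : algebraMap A (Localization.AtPrime p.asHomogeneousIdeal.toIdeal) s = 0 := by
        have h := congrArg (algebraMap A (Localization.AtPrime p.asHomogeneousIdeal.toIdeal))
          ((memI s).mp hs)
        rw [map_mul, map_zero] at h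
        exact (mul_eq_zero.mp h).resolve_right hap
      obtain ⟨t, ht, hts⟩ := exists_notMem_mul_eq_zero_of_algebraMap_eq_zero hs0
      exact ⟨t, ht, Subtype.ext hts⟩
  have hinf : ∀ w, w ∈ I → w ∈ J → w = 0 := by
    intro w hwI hwJ
    rw [← DirectSum.sum_support_decompose 𝒜 w]
    refine Finset.sum_eq_zero fun i _ => ?_
    set v : A := (decompose 𝒜 w i : A) with hv
    have hvv : v * v = 0 := (memJ v).mp (homJ i hwJ) v (homI i hwI)
    let L : Ideal A := Submodule.annihilator (Ideal.span {v})
    have homL : L.IsHomogeneous 𝒜 := (Ideal.homogeneous_span 𝒜 _ (by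
      rintro _ rfl
      exact ⟨i, SetLike.coe_mem _⟩)).annihilator
    have hL : ∀ p : ProjectiveSpectrum 𝒜, ¬ L ≤ p.asHomogeneousIdeal.toIdeal := by
      intro p hp
      have := hloc p
      have hv0 : algebraMap A (Localization.AtPrime p.asHomogeneousIdeal.toIdeal) v = 0 := by
        have h := congrArg (algebraMap A (Localization.AtPrime p.asHomogeneousIdeal.toIdeal)) hvv
        rw [map_mul, map_zero] at h
        exact mul_self_eq_zero.mp h
      obtain ⟨s, hs, hsv⟩ := exists_notMem_mul_eq_zero_of_algebraMap_eq_zero hv0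
      exact hs (hp ((Submodule.mem_annihilator_span_singleton v s).mpr hsv))
    obtain ⟨n, hn⟩ := homL.irrelevant_le_radical hL hxirr
    exact (mul_left_mem_nonZeroDivisors_eq_zero_iff (pow_mem hx n)).mp
      ((Submodule.mem_annihilator_span_singleton v _).mp hn)
  have hrad := (homI.sup homJ).irrelevant_le_radical hIJ
  obtain ⟨n, hn⟩ := hrad hxirr
  obtain ⟨m, hm⟩ := hrad hyirr
  obtain ⟨u, hu, v, hv, huv⟩ := Submodule.mem_sup.mp hn
  obtain ⟨u', hu', v', hv', huv'⟩ := Submodule.mem_sup.mp hm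
  have hxn := pow_mem hx n
  -- `u * v'` and `u' * v` vanish, so `y ^ m * u = (u' + v') * u = u' * (u + v) = x ^ n * u'`.
  have h1 : y ^ m * u = x ^ n * u' := by
    rw [← huv, ← huv']
    linear_combination (memJ v').mp hv' u hu - (memJ v).mp hv u' hu'
  obtain ⟨w, rfl⟩ := exists_eq_pow_mul_of_regular_pair hx hxy m n h1
  have hwI : w ∈ I := by
    rw [memI]
    refine (mul_left_mem_nonZeroDivisors_eq_zero_iff hxn).mp ?_
    rw [← mul_assoc]
    exact (memI _).mp hu
  have hwJ : 1 - w ∈ J := by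
    rw [memJ]
    intro s hs
    refine (mul_left_mem_nonZeroDivisors_eq_zero_iff hxn).mp ?_
    linear_combination (memJ v).mp hv s hs - s * huv
  have hI : I ≠ ⊤ := fun h => ha (by simpa [h] using memI 1)
  have hJ : J ≠ ⊤ := fun h => hb (by
    simpa [h] using (memJ 1).mp (h ▸ Submodule.mem_top) b ((memI b).mpr (by rw [mul_comm, hab])))
  have hone : (1 : A) ∈ HomogeneousIdeal.irrelevant 𝒜 := by
    have := add_mem (homI.le_irrelevant h0 hI hwI) (homJ.le_irrelevant h0 hJ hwJ)
    simpa using this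
  rw [HomogeneousIdeal.mem_irrelevant_iff, GradedRing.proj_apply,
    DirectSum.decompose_of_mem_same 𝒜 SetLike.GradedOne.one_mem] at hone
  exact one_ne_zero hone

end Graded

/-! ### Homogeneous localizations -/

namespace HomogeneousLocalization

variable {A σ : Type*} [CommRing A] [SetLike σ A] [AddSubgroupClass σ A]
  {𝒜 : ℕ → σ} [GradedRing 𝒜] [IsDomain A] {q : Ideal A} [q.IsPrime]

open DirectSum

/-- Divisibility in the homogeneous localization can be tested in the localization: take
homogeneous components of a quotient. -/
theorem AtPrime.dvd_of_val_dvd_val {α β : AtPrime 𝒜 q}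
    (h : α.val ∣ β.val) : α ∣ β := by
  classical
  obtain ⟨γ, hγ⟩ := h
  obtain ⟨⟨i, ⟨g, hg⟩, ⟨h, hh⟩, hhq⟩, rfl⟩ := mk_surjective α
  obtain ⟨⟨j, ⟨g', hg'⟩, ⟨h', hh'⟩, hhq'⟩, rfl⟩ := mk_surjective β
  obtain ⟨⟨r, s⟩, rfl⟩ := Localization.mkHom_surjective γ
  simp only [val_mk, Localization.mkHom_apply, Localization.mk_mul] at hγ
  rw [Localization.mk_eq_mk_iff, Localization.r_iff_exists] at hγ
  obtain ⟨c, hc⟩ := hγ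
  have hc0 : (c : A) ≠ 0 := fun h => c.2 (h ▸ q.zero_mem)
  have hc := mul_left_cancel₀ hc0 hc
  simp only [Submonoid.coe_mul] at hc
  obtain ⟨k, hk⟩ : ∃ k, (decompose 𝒜 (s : A) k : A) ∉ q := by
    by_contra! hcon
    refine s.2 ?_
    rw [← DirectSum.sum_support_decompose 𝒜 (s : A)]
    exact Ideal.sum_mem _ fun k _ => hcon k
  have hcomp : (h * decompose 𝒜 (s : A) k) * g' = h' * (g * decompose 𝒜 r k) := by
    have e1 := DirectSum.coe_decompose_mul_add_of_left_mem 𝒜 (a := h * g') (b := (s : A))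
      (i := i + j) (j := k) (SetLike.GradedMul.mul_mem hh hg')
    have e2 := DirectSum.coe_decompose_mul_add_of_left_mem 𝒜 (a := h' * g) (b := r)
      (i := j + i) (j := k) (SetLike.GradedMul.mul_mem hh' hg)
    have e3 : h * g' * (s : A) = h' * g * r := by linear_combination hc
    rw [e3, add_comm i j, e2] at e1
    linear_combination -e1
  refine ⟨mk ⟨k, decompose 𝒜 r k, decompose 𝒜 (s : A) k, hk⟩, ?_⟩
  rw [← mk_mul]
  refine val_injective _ ?_
  simp only [val_mk]
  rw [Localization.mk_eq_mk_iff, Localization.r_iff_exists]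
  exact ⟨1, by simpa using hcomp⟩

instance AtPrime.isDomain : IsDomain (AtPrime 𝒜 q) :=
  (val_injective q.primeCompl).isDomain (algebraMap (AtPrime 𝒜 q) (Localization.AtPrime q))

/-- The degree zero part of a localization that is a principal ideal domain is one as well: total
divisibility and well-foundedness of strict divisibility are inherited. -/
theorem AtPrime.isPrincipalIdealRing [IsPrincipalIdealRing (Localization.AtPrime q)] :
    IsPrincipalIdealRing (AtPrime 𝒜 q) := by
  have hval : ValuationRing (AtPrime 𝒜 q) := by
    rw [ValuationRing.iff_dvd_total]
    constructor
    intro α β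
    have : ValuationRing (Localization.AtPrime q) := inferInstance
    exact (ValuationRing.dvd_total α.val β.val).imp dvd_of_val_dvd_val dvd_of_val_dvd_val
  have hwf : WfDvdMonoid (AtPrime 𝒜 q) := by
    constructor
    refine Subrelation.wf (r := InvImage DvdNotUnit (HomogeneousLocalization.val)) ?_
      (InvImage.wf _ (IsWellFounded.wf : WellFounded (DvdNotUnit (α := Localization.AtPrime q))))
    rintro α β ⟨hα, γ, hγ, rfl⟩
    refine ⟨fun h => hα (val_injective _ (by rw [h, val_zero])), γ.val, ?_, val_mul _ _⟩
    rwa [isUnit_iff_isUnit_val]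
  exact ((IsBezout.TFAE (R := AtPrime 𝒜 q)).out 3 1).mp hwf

end HomogeneousLocalization

/-! ### Regular sequences: depth and dimension of quotients -/

section RegularSequences

open RingTheory.Sequence Pointwise

theorem Ideal.smul_top_quotSMulTop_ne_top {R : Type*} [CommRing R] {M : Type*}
    [AddCommGroup M] [Module R M] {I : Ideal R} {r : R} (hr : r ∈ I)
    (hI : I • (⊤ : Submodule R M) ≠ ⊤) : I • (⊤ : Submodule R (QuotSMulTop r M)) ≠ ⊤ := by
  intro eq
  refine hI ?_
  simpa [Submodule.comap_smul_top_of_surjective I _ (Submodule.mkQ_surjective _),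
    Submodule.smul_mono_left ((Ideal.span_singleton_le_iff_mem I).mpr hr),
    ← Submodule.ideal_span_singleton_smul] using congrArg (Submodule.comap (Submodule.mkQ _)) eq

open Abelian Limits in
/-- If an ideal contains two `M`-regular sequences, the quotient by the shorter one admits a regular
sequence in the ideal whose length is the difference. By the Rees theorem the longer sequence
makes `Ext` groups vanish, and each element of the shorter one costs one degree. -/
theorem RingTheory.Sequence.IsRegular.exists_isRegular_quotient.{u} {R : Type u} [CommRing R]
    [IsNoetherianRing R] (I : Ideal R) {M : Type u} [AddCommGroup M] [Module R M]
    [Module.Finite R M] (hM : I • (⊤ : Submodule R M) ≠ ⊤) {rs ss : List R} {k : ℕ}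
    (hrs : IsRegular M rs) (hrsI : ∀ r ∈ rs, r ∈ I) (hss : IsRegular M ss)
    (hssI : ∀ s ∈ ss, s ∈ I) (hlen : ss.length = rs.length + k) :
    ∃ ts : List R, ts.length = k ∧ (∀ t ∈ ts, t ∈ I) ∧
      IsRegular (M ⧸ (Ideal.ofList rs • ⊤ : Submodule R M)) ts := by
  induction rs generalizing M ss with
  | nil =>
    refine ⟨ss, by simpa using hlen, hssI, ?_⟩
    refine ((Submodule.quotEquivOfEqBot _ ?_).isRegular_congr ss).mpr hss
    rw [Ideal.ofList_nil, Submodule.bot_smul]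
  | cons r rs ih =>
    rw [isRegular_cons_iff] at hrs
    simp only [List.mem_cons, forall_eq_or_imp] at hrsI
    simp only [List.length_cons] at hlen
    have hsupp : Module.support R (R ⧸ I) = PrimeSpectrum.zeroLocus I := by
      rw [Module.support_eq_zeroLocus, Ideal.annihilator_quotient]
    have hM' := Ideal.smul_top_quotSMulTop_ne_top hrsI.1 hM
    have hext := ModuleCat.subsingleton_ext_of_exists_isRegular I (ModuleCat.of R (R ⧸ I))
      hsupp.le (ModuleCat.of R M) hM.lt_top ss hssI hss
    have hext' : ∀ i < rs.length + k, Subsingleton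
        (Ext (ModuleCat.of R (R ⧸ I)) (ModuleCat.of R (QuotSMulTop r M)) i) := by
      intro i hi
      have zero1 := AddCommGrpCat.isZero_of_iff_subsingleton.mpr (hext i (by omega))
      have zero2 := AddCommGrpCat.isZero_of_iff_subsingleton.mpr (hext (i + 1) (by omega))
      have hr : IsSMulRegular (ModuleCat.of R M) r := hrs.1
      exact AddCommGrpCat.subsingleton_of_isZero <| ShortComplex.Exact.isZero_of_both_zeros
        ((Ext.covariant_sequence_exact₃' _ hr.smulShortComplex_shortExact) i (i + 1) rfl)
        (zero1.eq_zero_of_src _) (zero2.eq_zero_of_tgt _)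
    obtain ⟨ss', hlen', hss'I, hss'⟩ := ModuleCat.exists_isRegular_of_exists_subsingleton_ext I
      (rs.length + k) (ModuleCat.of R (QuotSMulTop r M)) hM'.lt_top (ModuleCat.of R (R ⧸ I))
      hsupp hext'
    obtain ⟨ts, h1, h2, h3⟩ := ih hM' hrs.2 hrsI.2 hss' hss'I hlen'
    exact ⟨ts, h1, h2, ((Submodule.quotOfListConsSMulTopEquivQuotSMulTopInner M r
      rs).isRegular_congr ts).mpr h3⟩

theorem RingTheory.Sequence.IsWeaklyRegular.supportDim_add_length_le {R : Type*} [CommRing R]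
    [IsNoetherianRing R] {M : Type*} [AddCommGroup M] [Module R M] [Module.Finite R M]
    {rs : List R} (h : IsWeaklyRegular M rs) :
    Module.supportDim R (M ⧸ (Ideal.ofList rs • ⊤ : Submodule R M)) + rs.length ≤
      Module.supportDim R M := by
  induction rs generalizing M with
  | nil =>
    rw [Ideal.ofList_nil, Submodule.bot_smul]
    simpa using (Module.supportDim_eq_of_equiv (Submodule.quotEquivOfEqBot ⊥ rfl)).le
  | cons r rs ih =>
    rw [isWeaklyRegular_cons_iff] at h
    rw [Module.supportDim_eq_of_equiv
      (Submodule.quotOfListConsSMulTopEquivQuotSMulTopInner M r rs), List.length_cons,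
      Nat.cast_add, ← add_assoc, Nat.cast_one]
    exact le_trans (by gcongr; exact ih h.2)
      (Module.supportDim_quotSMulTop_succ_le_of_notMem_minimalPrimes
        fun _ hp => h.1.notMem_of_mem_minimalPrimes hp)

/-! ### Ideals generated by variables -/

namespace MvPolynomial

theorem span_X_image_ne_top {σ R : Type*} [CommRing R] [Nontrivial R] (s : Set σ) :
    Ideal.span (X '' s : Set (MvPolynomial σ R)) ≠ ⊤ := by
  rw [Ideal.ne_top_iff_one, mem_ideal_span_X_image]
  push Not
  exact ⟨0, by simp, by simp⟩

/-- Modulo a set of variables, any other variable is a nonzerodivisor. -/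
theorem mem_span_X_image_of_X_mul_mem {σ R : Type*} [CommRing R] {s : Set σ} {i : σ} (hi : i ∉ s)
    {p : MvPolynomial σ R} (h : X i * p ∈ Ideal.span (X '' s : Set (MvPolynomial σ R))) :
    p ∈ Ideal.span (X '' s : Set (MvPolynomial σ R)) := by
  rw [mem_ideal_span_X_image] at h ⊢
  intro m hm
  obtain ⟨j, hj, hmj⟩ := h (Finsupp.single i 1 + m) (by
    rw [mem_support_iff, coeff_X_mul]
    exact mem_support_iff.mp hm)
  refine ⟨j, hj, ?_⟩
  have hij : i ≠ j := fun h => hi (h ▸ hj)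
  simpa [Finsupp.single_apply, hij] using hmj

theorem isRegular_ofFn_X {R : Type*} [CommRing R] [Nontrivial R] (n : ℕ) :
    IsRegular (MvPolynomial (Fin n) R) (List.ofFn fun i => (X i : MvPolynomial (Fin n) R)) := by
  have hof : ∀ k, Ideal.ofList ((List.ofFn fun i : Fin n => (X i : MvPolynomial (Fin n) R)).take k)
      • (⊤ : Ideal (MvPolynomial (Fin n) R)) = Ideal.span (X '' {i : Fin n | (i : ℕ) < k}) := by
    intro k
    rw [smul_eq_mul, Ideal.mul_top, Ideal.ofList]
    congr 1
    ext p
    simp only [Set.mem_ofPred_eq, List.mem_take_iff_getElem, List.getElem_ofFn, List.length_ofFn,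
      Set.mem_image]
    constructor
    · rintro ⟨i, hi, rfl⟩
      exact ⟨⟨i, by omega⟩, by simp; omega, rfl⟩
    · rintro ⟨i, hi, rfl⟩
      exact ⟨i, by have := i.2; omega, rfl⟩
  refine ⟨⟨fun k hk => ?_⟩, fun h => ?_⟩
  · rw [isSMulRegular_on_quot_iff_lsmul_comap_le, hof]
    intro p hp
    rw [List.getElem_ofFn] at hp
    exact mem_span_X_image_of_X_mul_mem (by simp) hp
  · have h' := hof n
    rw [List.take_of_length_le (by simp)] at h'
    exact span_X_image_ne_top _ (h'.symm.trans h.symm)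

theorem isPrime_span_X_image {σ R : Type*} [CommRing R] [IsDomain R] (s : Set σ) :
    (Ideal.span (X '' s : Set (MvPolynomial σ R))).IsPrime := by
  classical
  -- The ideal is the kernel of the endomorphism that kills the variables in `s`.
  let φ : MvPolynomial σ R →ₐ[R] MvPolynomial σ R := aeval fun i => if i ∈ s then 0 else X i
  have hφ : ∀ p, p - φ p ∈ Ideal.span (X '' s : Set (MvPolynomial σ R)) := by
    intro p
    induction p using MvPolynomial.induction_on with
    | C r => simp [φ, algebraMap_eq]
    | add p q hp hq =>
      rw [map_add, add_sub_add_comm]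
      exact add_mem hp hq
    | mul_X p i hp =>
      have hi : X i - φ (X i) ∈ Ideal.span (X '' s : Set (MvPolynomial σ R)) := by
        by_cases his : i ∈ s
        · simpa [φ, his] using Ideal.subset_span (Set.mem_image_of_mem X his)
        · simp [φ, his]
      rw [map_mul]
      have h : p * X i - φ p * φ (X i) = (p - φ p) * X i + φ p * (X i - φ (X i)) := by ring
      rw [h]
      exact add_mem (Ideal.mul_mem_right _ _ hp) (Ideal.mul_mem_left _ _ hi)
  have hker : Ideal.span (X '' s : Set (MvPolynomial σ R)) = RingHom.ker φ := by
    refine le_antisymm (Ideal.span_le.mpr ?_) fun p hp => ?_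
    · rintro _ ⟨i, hi, rfl⟩
      simp [φ, hi]
    · simpa [(RingHom.mem_ker).mp hp] using hφ p
  rw [hker]
  exact RingHom.ker_isPrime _

end MvPolynomial

/-! ### Depth and dimension of weighted complete intersections -/

namespace WeightedProj

attribute [local instance] MvPolynomial.weightedGradedAlgebra

universe u

variable {K : Type u} [Field K] {n c : ℕ} (a : Fin n → ℕ) (d : Fin c → ℕ)
  (f : (j : Fin c) → weightedHomogeneousSubmodule K a (d j))

theorem ofList_smul_top_eq :
    Ideal.ofList (List.ofFn fun j => (f j : MvPolynomial (Fin n) K)) •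
      (⊤ : Ideal (MvPolynomial (Fin n) K)) = (ideal a d f).toIdeal := by
  rw [smul_eq_mul, Ideal.mul_top]
  change Ideal.span _ = Ideal.span _
  congr 1
  ext p
  simp [List.mem_ofFn]

theorem ringKrullDim_coordRing_add_le (hf : IsCompleteIntersection a d f) :
    ringKrullDim (coordRing a d f) + c ≤ n := by
  have h := hf.toIsWeaklyRegular.supportDim_add_length_le
  rw [Module.supportDim_self_eq_ringKrullDim, ringKrullDim_of_isNoetherianRing,
    ringKrullDim_eq_zero_of_field, List.length_ofFn, Nat.card_fin, zero_add,
    Module.supportDim_eq_of_equiv (Submodule.quotEquivOfEq _ _ (ofList_smul_top_eq a d f)),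
    Module.supportDim_quotient_eq_ringKrullDim] at h
  exact h

variable {a d f}

theorem mem_span_range_X {k : ℕ} (hk : 0 < k) {p : MvPolynomial (Fin n) K}
    (hp : p ∈ weightedHomogeneousSubmodule K a k) :
    p ∈ Ideal.span (Set.range (X : Fin n → MvPolynomial (Fin n) K)) := by
  rw [← Set.image_univ, mem_ideal_span_X_image]
  intro m hm
  by_contra! hcon
  have : m = 0 := Finsupp.ext fun i => hcon i (Set.mem_univ i)
  have h := hp (mem_support_iff.mp hm)
  rw [this, map_zero] at h
  omega

/-- The coordinate ring of a complete intersection curve has depth at least two at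
the origin, as the variables form a regular sequence of length `c + 2`. -/
theorem exists_regular_pair {a : Fin (c + 2) → ℕ} {d : Fin c → ℕ}
    {f : (j : Fin c) → weightedHomogeneousSubmodule K a (d j)} (hd : ∀ j, 0 < d j) (hf : IsCompleteIntersection a d f) :
    ∃ x ∈ Ideal.span (Set.range (X : Fin (c + 2) → MvPolynomial (Fin (c + 2)) K)),
    ∃ y ∈ Ideal.span (Set.range (X : Fin (c + 2) → MvPolynomial (Fin (c + 2)) K)),
      Ideal.Quotient.mk (ideal a d f).toIdeal x ∈ nonZeroDivisors (coordRing a d f) ∧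
      ∀ t s : coordRing a d f, Ideal.Quotient.mk (ideal a d f).toIdeal y * t =
        Ideal.Quotient.mk (ideal a d f).toIdeal x * s →
          ∃ w, t = Ideal.Quotient.mk (ideal a d f).toIdeal x * w := by
  have hne : (Ideal.span (Set.range (X : Fin (c + 2) → MvPolynomial (Fin (c + 2)) K))) •
      (⊤ : Ideal (MvPolynomial (Fin (c + 2)) K)) ≠ ⊤ := by
    rw [smul_eq_mul, Ideal.mul_top, ← Set.image_univ]
    exact span_X_image_ne_top _
  obtain ⟨ts, hts, htsI, hreg⟩ := hf.exists_isRegular_quotient _ hne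
    (fun r hr => by
      obtain ⟨j, rfl⟩ := (List.mem_ofFn' _ _).mp hr
      exact mem_span_range_X (hd j) (f j).2)
    (isRegular_ofFn_X (c + 2)) (fun s hs => by
      obtain ⟨j, rfl⟩ := (List.mem_ofFn' _ _).mp hs
      exact Ideal.subset_span ⟨j, rfl⟩) (k := 2) (by simp)
  obtain ⟨x, y, rfl⟩ := List.length_eq_two.mp hts
  rw [(Submodule.quotEquivOfEq _ _ (ofList_smul_top_eq a d f)).isRegular_congr,
    isRegular_cons_iff, isRegular_cons_iff] at hreg
  obtain ⟨hx, hy, -⟩ := hreg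
  have hsmul : ∀ (r : MvPolynomial (Fin (c + 2)) K)
      (t : MvPolynomial (Fin (c + 2)) K ⧸ (ideal a d f).toIdeal),
      r • t = Ideal.Quotient.mk (ideal a d f).toIdeal r * t := by
    intro r t
    obtain ⟨t, rfl⟩ := Ideal.Quotient.mk_surjective t
    rfl
  refine ⟨x, htsI x (by simp), y, htsI y (by simp), ?_, fun t s hts => ?_⟩
  · rw [mem_nonZeroDivisors_iff_right]
    intro t ht
    refine hx.right_eq_zero_of_smul ?_
    rw [hsmul, mul_comm]
    exact ht
  · rw [isSMulRegular_on_quot_iff_lsmul_comap_le] at hy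
    obtain ⟨w, -, hw⟩ := hy (show t ∈ _ from ⟨s, trivial, by
      change x • s = y • t
      rw [hsmul, hsmul]
      exact hts.symm⟩)
    refine ⟨w, ?_⟩
    rw [← hw]
    exact hsmul _ _

end WeightedProj

end RegularSequences

/-! ### Weighted complete intersection curves -/

namespace WeightedProj

attribute [local instance] MvPolynomial.weightedGradedAlgebra

universe u

variable {K : Type u} [Field K] {n c : ℕ} {a : Fin n → ℕ} {d : Fin c → ℕ}
  {f : (j : Fin c) → weightedHomogeneousSubmodule K a (d j)}

theorem isUnit_of_mem_piece_zero (ha : ∀ i, 0 < a i) (r : coordRing a d f)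
    (hr : r ∈ QuotGrading.piece (weightedHomogeneousSubmodule K a) (ideal a d f) 0) (h : r ≠ 0) :
    IsUnit r := by
  obtain ⟨p, hp, rfl⟩ := hr
  obtain ⟨k, rfl⟩ : ∃ k, p = C k := by
    refine ⟨coeff 0 p, ?_⟩
    ext m
    rw [coeff_C]
    split_ifs with hm
    · rw [hm]
    · by_contra hne
      refine hm (Finsupp.ext fun i => ?_).symm
      have h0 : Finsupp.weight a m = 0 := hp hne
      have := Finsupp.le_weight a (ha i).ne' m
      simp only [Finsupp.coe_zero, Pi.zero_apply]
      omega
  have hk : k ≠ 0 := by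
    rintro rfl
    exact h (by simp)
  exact ((isUnit_iff_ne_zero.mpr hk).map C).map (Ideal.Quotient.mk (ideal a d f).toIdeal)

theorem ideal_le_span_range_X (hd : ∀ j, 0 < d j) :
    (ideal a d f).toIdeal ≤ Ideal.span (Set.range (X : Fin n → MvPolynomial (Fin n) K)) := by
  refine Ideal.span_le.mpr ?_
  rintro _ ⟨j, rfl⟩
  exact mem_span_range_X (hd j) (f j).2

theorem mk_mem_irrelevant (ha : ∀ i, 0 < a i) {p : MvPolynomial (Fin n) K}
    (hp : p ∈ Ideal.span (Set.range (X : Fin n → MvPolynomial (Fin n) K))) :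
    Ideal.Quotient.mk (ideal a d f).toIdeal p ∈ HomogeneousIdeal.irrelevant
      (QuotGrading.piece (weightedHomogeneousSubmodule K a) (ideal a d f)) := by
  have h : Ideal.span (Set.range (X : Fin n → MvPolynomial (Fin n) K)) ≤
      (HomogeneousIdeal.irrelevant (QuotGrading.piece (weightedHomogeneousSubmodule K a)
        (ideal a d f))).toIdeal.comap (Ideal.Quotient.mk (ideal a d f).toIdeal) := by
    refine Ideal.span_le.mpr ?_
    rintro _ ⟨i, rfl⟩
    exact HomogeneousIdeal.mem_irrelevant_of_mem _ (ha i)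
      (QuotGrading.mk_mem_piece _ _ (isWeightedHomogeneous_X K a i))
  exact h hp

theorem irrelevant_le_map_span_range_X :
    (HomogeneousIdeal.irrelevant
      (QuotGrading.piece (weightedHomogeneousSubmodule K a) (ideal a d f))).toIdeal ≤
      (Ideal.span (Set.range (X : Fin n → MvPolynomial (Fin n) K))).map
        (Ideal.Quotient.mk (ideal a d f).toIdeal) := by
  rw [HomogeneousIdeal.toIdeal_irrelevant_le]
  rintro k hk _ ⟨p, hp, rfl⟩
  exact Ideal.mem_map_of_mem _ (mem_span_range_X hk hp)

theorem exists_X_notMem (x : ProjectiveSpectrum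
    (QuotGrading.piece (weightedHomogeneousSubmodule K a) (ideal a d f))) :
    ∃ i, Ideal.Quotient.mk (ideal a d f).toIdeal (X i) ∉ x.asHomogeneousIdeal.toIdeal := by
  by_contra! h
  have hle := irrelevant_le_map_span_range_X (a := a) (d := d) (f := f)
  refine x.not_irrelevant_le (hle.trans ?_)
  rw [Ideal.map_span, Ideal.span_le]
  rintro _ ⟨_, ⟨i, rfl⟩, rfl⟩
  exact h i

/-- The variables in `s` generate a prime ideal of `coordRing a d f` as soon as the equations lie in
the ideal generated by these variables. -/
theorem isPrime_map_span_X {s : Set (Fin n)}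
    (h : (ideal a d f).toIdeal ≤ Ideal.span (X '' s : Set (MvPolynomial (Fin n) K))) :
    ((Ideal.span (X '' s : Set (MvPolynomial (Fin n) K))).map
      (Ideal.Quotient.mk (ideal a d f).toIdeal)).IsPrime := by
  have := isPrime_span_X_image (R := K) s
  exact Ideal.map_isPrime_of_surjective Ideal.Quotient.mk_surjective (by rwa [Ideal.mk_ker])

theorem X_mem_of_mk_X_mem_map {s : Set (Fin n)} {i : Fin n}
    (h : (ideal a d f).toIdeal ≤ Ideal.span (X '' s : Set (MvPolynomial (Fin n) K)))
    (hi : Ideal.Quotient.mk (ideal a d f).toIdeal (X i) ∈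
      (Ideal.span (X '' s : Set (MvPolynomial (Fin n) K))).map
        (Ideal.Quotient.mk (ideal a d f).toIdeal)) : i ∈ s := by
  have hX : (X i : MvPolynomial (Fin n) K) ∈ Ideal.span (X '' s) := by
    obtain ⟨p, hp, hpi⟩ := (Ideal.mem_map_iff_of_surjective _ Ideal.Quotient.mk_surjective).mp hi
    have := h (Ideal.Quotient.eq.mp hpi.symm)
    simpa using add_mem this hp
  obtain ⟨j, hj, hij⟩ := mem_ideal_span_X_image.mp hX (Finsupp.single i 1) (by simp)
  rw [Finsupp.single_apply_ne_zero] at hij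
  exact hij.1 ▸ hj

theorem homogeneous_le_map_span_range_X (ha : ∀ i, 0 < a i) {I : Ideal (coordRing a d f)}
    (hI : I.IsHomogeneous (QuotGrading.piece (weightedHomogeneousSubmodule K a) (ideal a d f)))
    (hne : I ≠ ⊤) :
    I ≤ (Ideal.span (Set.range (X : Fin n → MvPolynomial (Fin n) K))).map
      (Ideal.Quotient.mk (ideal a d f).toIdeal) :=
  (hI.le_irrelevant (isUnit_of_mem_piece_zero ha) hne).trans irrelevant_le_map_span_range_X

variable {a : Fin (c + 2) → ℕ} {d : Fin c → ℕ}
  {f : (j : Fin c) → weightedHomogeneousSubmodule K a (d j)}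

theorem height_le_two (hf : IsCompleteIntersection a d f) {P : Ideal (coordRing a d f)}
    (hP : P.IsPrime) : P.height ≤ 2 := by
  have h1 : (P.height : WithBot ℕ∞) ≤ ringKrullDim (coordRing a d f) :=
    Ideal.height_le_ringKrullDim_of_ne_top hP.ne_top
  have h2 := ringKrullDim_coordRing_add_le a d f hf
  have h3 : ((P.height + c : ℕ∞) : WithBot ℕ∞) ≤ ((2 + c : ℕ∞) : WithBot ℕ∞) := by
    refine le_trans (le_trans ?_ h2) (le_of_eq ?_)
    · push_cast
      gcongr
    · push_cast
      exact add_comm _ _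
  exact (ENat.add_le_add_iff_right (ENat.natCast_ne_top c)).mp (WithBot.coe_le_coe.mp h3)

/-- A point of the curve is properly contained in the ideal of the origin of the affine cone, which
has height at most two. -/
theorem height_le_one (ha : ∀ i, 0 < a i) (hd : ∀ j, 0 < d j) (hf : IsCompleteIntersection a d f)
    (x : ProjectiveSpectrum
      (QuotGrading.piece (weightedHomogeneousSubmodule K a) (ideal a d f))) :
    x.asHomogeneousIdeal.toIdeal.height ≤ 1 := by
  have hprime := isPrime_map_span_X (s := Set.univ)
    (by rw [Set.image_univ]; exact ideal_le_span_range_X (f := f) hd)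
  rw [Set.image_univ] at hprime
  obtain ⟨i, hi⟩ := exists_X_notMem x
  have hlt : x.asHomogeneousIdeal.toIdeal <
      (Ideal.span (Set.range (X : Fin (c + 2) → MvPolynomial (Fin (c + 2)) K))).map
        (Ideal.Quotient.mk (ideal a d f).toIdeal) := by
    refine lt_of_le_of_ne (homogeneous_le_map_span_range_X ha x.asHomogeneousIdeal.isHomogeneous
      x.isPrime.ne_top) fun h => hi ?_
    rw [h]
    exact Ideal.mem_map_of_mem _ (Ideal.subset_span ⟨i, rfl⟩)
  have h1 := Order.add_one_le_of_lt (Ideal.height_strict_mono_of_isPrime_of_isPrime hlt)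
  have h2 := h1.trans (height_le_two hf hprime)
  exact (ENat.add_le_add_iff_right ENat.one_ne_top).mp (h2.trans_eq one_add_one_eq_two.symm)

/-- The local rings of the affine cone at the points of a quasi-smooth curve are regular of
dimension at most one. -/
theorem isDomain_and_isPrincipalIdealRing_localization (ha : ∀ i, 0 < a i) (hd : ∀ j, 0 < d j)
    (hf : IsCompleteIntersection a d f) (hs : IsQuasiSmooth a d f) (x : ProjectiveSpectrum
      (QuotGrading.piece (weightedHomogeneousSubmodule K a) (ideal a d f))) :
    IsDomain (Localization.AtPrime x.asHomogeneousIdeal.toIdeal) ∧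
      IsPrincipalIdealRing (Localization.AtPrime x.asHomogeneousIdeal.toIdeal) := by
  have : Algebra.IsSmoothAt K x.asHomogeneousIdeal.toIdeal :=
    hs ⟨x.asHomogeneousIdeal.toIdeal, x.isPrime⟩ (exists_X_notMem x)
  have := Algebra.IsSmoothAt.isRegularLocalRing_localization K (coordRing a d f)
    x.asHomogeneousIdeal.toIdeal
  apply IsRegularLocalRing.isDomain_and_isPrincipalIdealRing_of_ringKrullDim_le_one
  rw [IsLocalization.AtPrime.ringKrullDim_eq_height x.asHomogeneousIdeal.toIdeal]
  exact_mod_cast height_le_one ha hd hf x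

theorem nontrivial_coordRing (hd : ∀ j, 0 < d j) : Nontrivial (coordRing a d f) := by
  refine Ideal.Quotient.nontrivial_iff.mpr (ne_top_of_le_ne_top ?_ (ideal_le_span_range_X hd))
  rw [← Set.image_univ]
  exact span_X_image_ne_top _

theorem isDomain_coordRing (ha : ∀ i, 0 < a i) (hd : ∀ j, 0 < d j)
    (hf : IsCompleteIntersection a d f) (hs : IsQuasiSmooth a d f) :
    IsDomain (coordRing a d f) := by
  have := nontrivial_coordRing (f := f) hd
  obtain ⟨x, hx, y, hy, hxreg, hxy⟩ := exists_regular_pair hd hf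
  exact isDomain_of_isDomain_localization_of_regular_pair
    (𝒜 := QuotGrading.piece (weightedHomogeneousSubmodule K a) (ideal a d f))
    (isUnit_of_mem_piece_zero ha)
    (fun p => (isDomain_and_isPrincipalIdealRing_localization ha hd hf hs p).1)
    (mk_mem_irrelevant ha hx) (mk_mem_irrelevant ha hy) hxreg hxy

/-- The curve is nonempty because its coordinate ring has positive depth; if that ring is a domain,
the zero ideal is a generic point. -/
theorem irreducibleSpace_locus (ha : ∀ i, 0 < a i) (hd : ∀ j, 0 < d j)
    (hf : IsCompleteIntersection a d f) [IsDomain (coordRing a d f)] :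
    IrreducibleSpace (locus a d f) := by
  obtain ⟨x, hx, -, -, hxreg, -⟩ := exists_regular_pair hd hf
  let η : ProjectiveSpectrum
      (QuotGrading.piece (weightedHomogeneousSubmodule K a) (ideal a d f)) :=
    ⟨⊥, Ideal.isPrime_bot, fun h => nonZeroDivisors.ne_zero hxreg
      (Ideal.mem_bot.mp (h (mk_mem_irrelevant ha hx)))⟩
  have hη : closure ({η} : Set (ProjectiveSpectrum
      (QuotGrading.piece (weightedHomogeneousSubmodule K a) (ideal a d f)))) = Set.univ :=
    Set.eq_univ_of_forall fun y => (ProjectiveSpectrum.le_iff_mem_closure _ η y).mp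
      (bot_le (a := y.asHomogeneousIdeal))
  have hirr : IsIrreducible (Set.univ : Set (ProjectiveSpectrum
      (QuotGrading.piece (weightedHomogeneousSubmodule K a) (ideal a d f)))) :=
    hη ▸ isIrreducible_singleton.closure
  have h : IrreducibleSpace (ProjectiveSpectrum
      (QuotGrading.piece (weightedHomogeneousSubmodule K a) (ideal a d f))) :=
    (irreducibleSpace_def _).mpr hirr
  exact h

theorem isNonsingular_locus (ha : ∀ i, 0 < a i) (hd : ∀ j, 0 < d j)
    (hf : IsCompleteIntersection a d f) (hs : IsQuasiSmooth a d f) :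
    IsNonsingular (locus a d f) := by
  intro (x : ProjectiveSpectrum
    (QuotGrading.piece (weightedHomogeneousSubmodule K a) (ideal a d f)))
  have := isDomain_coordRing ha hd hf hs
  have := (isDomain_and_isPrincipalIdealRing_localization ha hd hf hs x).2
  have := HomogeneousLocalization.AtPrime.isPrincipalIdealRing
    (𝒜 := QuotGrading.piece (weightedHomogeneousSubmodule K a) (ideal a d f))
    (q := x.asHomogeneousIdeal.toIdeal)
  exact IsRegularLocalRing.of_ringEquiv (Proj.stalkIso
    (QuotGrading.piece (weightedHomogeneousSubmodule K a) (ideal a d f))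
    x).symm.commRingCatIsoToRingEquiv

/-- An irreducible curve that contains a coordinate line is that line. Let `P` be the generic point
of the curve and `y` its point above the generic point of the line. If `P` were strictly below `y`,
then `P`, `y`, the coordinate point of the line, and the origin would form a chain of four prime
ideals in the coordinate ring, which has dimension at most two. -/
theorem stratum_eq_support (ha : ∀ i, 0 < a i)
    (hf : IsCompleteIntersection a d f) [IrreducibleSpace (locus a d f)] {s : Finset (Fin (c + 2))}
    (hs : s.card = 2) (hsub : stratum K a s ⊆ support a d f) :
    stratum K a s = support a d f := by
  obtain ⟨i, j, hij, rfl⟩ := Finset.card_eq_two.mp hs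
  let T : Set (Fin (c + 2)) := {k | k ∉ ({i, j} : Finset (Fin (c + 2)))}
  let T' : Set (Fin (c + 2)) := {k | k ≠ j}
  let Q : Ideal (MvPolynomial (Fin (c + 2)) K) := Ideal.span (X '' T)
  have hXQ : ∀ k ∈ T, (X k : MvPolynomial (Fin (c + 2)) K) ∈ Q :=
    fun k hk => Ideal.subset_span ⟨k, hk, rfl⟩
  have hiQ : (X i : MvPolynomial (Fin (c + 2)) K) ∉ Q := by
    intro h
    obtain ⟨k, hk, hik⟩ := mem_ideal_span_X_image.mp h (Finsupp.single i 1) (by simp)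
    rw [Finsupp.single_apply_ne_zero] at hik
    exact hk (by simp [hik.1])
  let ζ : ProjectiveSpectrum (weightedHomogeneousSubmodule K a) :=
    { asHomogeneousIdeal := ⟨Q, Ideal.homogeneous_span _ _ (by
        rintro _ ⟨k, -, rfl⟩
        exact ⟨a k, isWeightedHomogeneous_X K a k⟩)⟩
      isPrime := isPrime_span_X_image T
      not_irrelevant_le := fun h => hiQ (h (HomogeneousIdeal.mem_irrelevant_of_mem _ (ha i)
        (isWeightedHomogeneous_X K a i))) }
  have hζ : ζ ∈ stratum K a {i, j} := by
    rintro _ ⟨k, hk, rfl⟩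
    exact hXQ k hk
  obtain ⟨y₀, hy⟩ := hsub hζ
  let y : ProjectiveSpectrum
    (QuotGrading.piece (weightedHomogeneousSubmodule K a) (ideal a d f)) := y₀
  let P : ProjectiveSpectrum
    (QuotGrading.piece (weightedHomogeneousSubmodule K a) (ideal a d f)) :=
    genericPoint (locus a d f)
  have hPle : ∀ z : ProjectiveSpectrum
      (QuotGrading.piece (weightedHomogeneousSubmodule K a) (ideal a d f)), P ≤ z := fun z =>
    (ProjectiveSpectrum.le_iff_mem_closure _ P z).mpr (by
      have h : closure {P} = Set.univ := genericPoint_closure (locus a d f)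
      exact h.symm ▸ Set.mem_univ z)
  have hymem : ∀ p, Ideal.Quotient.mk (ideal a d f).toIdeal p ∈ y.asHomogeneousIdeal ↔ p ∈ Q := by
    intro p
    change p ∈ (ProjectiveSpectrum.asHomogeneousIdeal
      (𝒜 := weightedHomogeneousSubmodule K a) (inclusion a d f y₀)) ↔ _
    rw [hy]
    rfl
  have hIQ : (ideal a d f).toIdeal ≤ Q := fun p hp => by
    rw [← hymem, Ideal.Quotient.eq_zero_iff_mem.mpr hp]
    exact zero_mem _
  by_cases hyP : y ≤ P
  · refine hsub.antisymm ?_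
    rintro _ ⟨z, rfl⟩
    rintro _ ⟨k, hk, rfl⟩
    exact hPle z (hyP ((hymem (X k)).mpr (hXQ k hk)))
  · exfalso
    have hQQ' : Q ≤ Ideal.span (X '' T') :=
      Ideal.span_mono (Set.image_mono fun k hk hkj => hk (by simp [hkj]))
    have hQ'M : Ideal.span (X '' T') ≤
        Ideal.span (X '' Set.univ : Set (MvPolynomial (Fin (c + 2)) K)) :=
      Ideal.span_mono (Set.image_mono (Set.subset_univ _))
    have hp2 := isPrime_map_span_X (hIQ.trans hQQ')
    have hp3 := isPrime_map_span_X (hIQ.trans (hQQ'.trans hQ'M))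
    have h01 : P.asHomogeneousIdeal.toIdeal < y.asHomogeneousIdeal.toIdeal :=
      ⟨hPle y, hyP⟩
    have h12 : y.asHomogeneousIdeal.toIdeal < (Ideal.span (X '' T')).map
        (Ideal.Quotient.mk (ideal a d f).toIdeal) := by
      refine ⟨fun t ht => ?_, fun h => hiQ ((hymem _).mp
        (h (Ideal.mem_map_of_mem _ (Ideal.subset_span ⟨i, hij, rfl⟩))))⟩
      obtain ⟨p, rfl⟩ := Ideal.Quotient.mk_surjective t
      exact Ideal.mem_map_of_mem _ (hQQ' ((hymem p).mp ht))
    have h23 : (Ideal.span (X '' T')).map (Ideal.Quotient.mk (ideal a d f).toIdeal) <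
        (Ideal.span (X '' Set.univ)).map (Ideal.Quotient.mk (ideal a d f).toIdeal) :=
      ⟨Ideal.map_mono hQ'M, fun h => X_mem_of_mk_X_mem_map (hIQ.trans hQQ')
        (h (Ideal.mem_map_of_mem _ (Ideal.subset_span ⟨j, Set.mem_univ j, rfl⟩))) rfl⟩
    have h0 := Order.add_one_le_of_lt (Ideal.height_strict_mono_of_isPrime_of_isPrime h01)
    have h1 := Order.add_one_le_of_lt (Ideal.height_strict_mono_of_isPrime_of_isPrime h12)
    have h2 := Order.add_one_le_of_lt (Ideal.height_strict_mono_of_isPrime_of_isPrime h23)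
    have h3 := height_le_two hf hp3
    have h4 : (3 : ℕ∞) ≤ 2 := calc
      (3 : ℕ∞) ≤ P.asHomogeneousIdeal.toIdeal.height + 1 + 1 + 1 := by
        rw [add_assoc, add_assoc]
        exact le_add_self
      _ ≤ 2 := by
        refine le_trans ?_ (h2.trans h3)
        gcongr
        refine le_trans ?_ h1
        gcongr
    exact absurd h4 (by decide)

end WeightedProj

theorem lemma3p4 {K : Type*} [Field K] [IsAlgClosed K] [CharZero K] {c : ℕ}
    (a : Fin (c + 2) → ℕ) (ha : ∀ i, 0 < a i) (d : Fin c → ℕ) (hd : ∀ j, 0 < d j)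
    (f : (j : Fin c) → MvPolynomial.weightedHomogeneousSubmodule K a (d j))
    (hf : WeightedProj.IsCompleteIntersection a d f) :
    (WeightedProj.IsQuasiSmooth a d f →
      IrreducibleSpace (WeightedProj.locus a d f) ∧
      ConnectedSpace (WeightedProj.locus a d f) ∧
      IsNonsingular (WeightedProj.locus a d f)) ∧
    ∀ s : Finset (Fin (c + 2)), s.card = 2 →
      WeightedProj.stratum K a s ⊆ WeightedProj.support a d f →
      WeightedProj.stratum K a s ≠ WeightedProj.support a d f →
      ¬ IrreducibleSpace (WeightedProj.locus a d f) := by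
  refine ⟨fun hs => ?_, fun s hs hsub hne hirr =>
    hne (WeightedProj.stratum_eq_support ha hf hs hsub)⟩
  have := WeightedProj.isDomain_coordRing ha hd hf hs
  have hirr := WeightedProj.irreducibleSpace_locus ha hd hf
  exact ⟨hirr, inferInstance, WeightedProj.isNonsingular_locus ha hd hf hs⟩
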